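/- All graphs are finite and simple, and $N_R[v]$ denotes the set consisting of $v$ and its neighbours in $R$. For an integer $k\ge 4$, a $k$-ring is a graph $R$ whose vertex set can be partitioned into nonempty sets $X_1,\dots,X_k$ (indices modulo $k$) such that every $X_i$ can be ordered as $X_i=\{u_i^1,\dots,u_i^{|X_i|}\}$ with $$X_i\subseteq N_R[u_i^{|X_i|}]\subseteq\dots\subseteq N_R[u_i^1]=X_{i-1}\cup X_i\cup X_{i+1}.$$ A $k$-hyperhole is a graph $H$ whose vertex set can be partitioned into nonempty cliques $X_1,\dots,X_k$ (indices modulo $k$) such that, for every $i$, every vertex of $X_i$ is adjacent to every vertex of $X_{i-1}\cup X_{i+1}$ and to no vertex outside $X_{i-1}\cup X_i\cup X_{i+1}$. A hyperhole is an $\ell$-hyperhole for some $\ell\ge 4$. A ($k$-)hyperhole in $R$ is an induced subgraph of $R$ that is a ($k$-)hyperhole. Theorem. Let $k\ge 4$ be an integer and let $R$ be a $k$-ring. Then $$\chi(R)=\max\{\chi(H) : H \text{ is a } k\text{-hyperhole in } R\}=\max\{\chi(H) : H\text{ is a hyperhole in } R\}.$$ In particular, $R$ contains a $k$-hyperhole,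 so the maxima are over nonempty sets. -/

import Mathlib

namespace ColoringRings

universe u

/-- The closed neighbourhood `N_G[v] = N_G(v) ∪ {v}`. -/
def closedNbhd {V : Type u} (G : SimpleGraph V) (v : V) : Set V :=
  insert v (G.neighborSet v)

/-- The sets `X i`, indexed cyclically by `ℤ/k`, partition the vertex set into nonempty sets. -/
structure IsCyclicPartition {V : Type u} {k : ℕ} (X : ZMod k → Set V) : Prop where
  nonempty : ∀ i, (X i).Nonempty
  disjoint : ∀ i j, i ≠ j → Disjoint (X i) (X j)
  cover : ⋃ i, X i = Set.univ

/-- `(X i)` is a ring partition of `G`: every `X i` can be listed without repetition as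
`u 0, u 1, …, u m` in such a way that
`X i ⊆ N[u m] ⊆ ⋯ ⊆ N[u 0] = X (i - 1) ∪ X i ∪ X (i + 1)`. -/
structure IsRingPartition {V : Type u} (G : SimpleGraph V) {k : ℕ} (X : ZMod k → Set V) :
    Prop where
  partition : IsCyclicPartition X
  ordering : ∀ i, ∃ (m : ℕ) (u : Fin (m + 1) → V),
    Function.Injective u ∧ Set.range u = X i ∧
    X i ⊆ closedNbhd G (u (Fin.last m)) ∧
    (∀ a b : Fin (m + 1), a ≤ b → closedNbhd G (u b) ⊆ closedNbhd G (u a)) ∧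
    closedNbhd G (u 0) = X (i - 1) ∪ X i ∪ X (i + 1)

/-- `G` is a `k`-ring, i.e. a ring of length `k ≥ 4`. -/
def IsKRing {V : Type u} (k : ℕ) (G : SimpleGraph V) : Prop :=
  4 ≤ k ∧ ∃ X : ZMod k → Set V, IsRingPartition G X

/-- `G` is a `k`-hyperhole, i.e. a hyperhole of length `k ≥ 4`: its vertex set is partitioned
into nonempty cliques `X i`, indexed cyclically, with `X i` complete to `X (i - 1) ∪ X (i + 1)`
and anticomplete to all vertices outside `X (i - 1) ∪ X i ∪ X (i + 1)`. -/
def IsKHyperhole {V : Type u} (k : ℕ) (G : SimpleGraph V) : Prop :=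
  4 ≤ k ∧ ∃ X : ZMod k → Set V, IsCyclicPartition X ∧
    (∀ i, G.IsClique (X i)) ∧
    (∀ i, ∀ x ∈ X i, ∀ y ∈ X (i - 1) ∪ X (i + 1), G.Adj x y) ∧
    (∀ i, ∀ x ∈ X i, ∀ y, y ∉ X (i - 1) ∪ X i ∪ X (i + 1) → ¬ G.Adj x y)

end ColoringRings

/-! It suffices to show that `R` is `r`-colourable whenever all its `k`-hyperholes are
(`IsKRing.colorable`). A cycle meeting each part once spans a hyperhole made of initial segments, so
the hypothesis bounds two adjacent segments together by `r` (`clique_le`) and, for `k = 2m + 1`, all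
segments of a cycle together by `m * r` (`hole_le`). For even `k`, positions counted up and down in
alternate parts give a colouring. For odd `k`, colour greedily part by part, alternately preferring
low and high colours. A conflict can occur only between the last part and part `0`; traced backwards
through the vertices that blocked the preferred colours, it closes up to a cycle whose segments have
at least `m * r + 1` vertices, contradicting `hole_le`. -/

namespace ColoringRings

open Finset

/-! ### Coordinates on a ring. -/

/-- Coordinates on a `k`-ring: `part v` is the index of the part that contains `v`, and `pos v` is
the place (from `0`) of `v` in the ordering of that part. -/
structure RingCoords {V : Type*} (R : SimpleGraph V) {k : ℕ} (part : V → ZMod k) (pos : V → ℕ) :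
    Prop where
  ext : ∀ v w, part v = part w → pos v = pos w → v = w
  exists_le : ∀ v a, a ≤ pos v → ∃ w, part w = part v ∧ pos w = a
  exists_first : ∀ i, ∃ v, part v = i ∧ pos v = 0
  adj_same : ∀ v w, part v = part w → v ≠ w → R.Adj v w
  adj_part : ∀ v w, R.Adj v w → part w = part v - 1 ∨ part w = part v ∨ part w = part v + 1
  adj_mono : ∀ v v' w, part v' = part v → pos v' ≤ pos v → R.Adj v w → v' ≠ w → R.Adj v' w
  adj_first : ∀ v w, pos v = 0 → part w = part v - 1 ∨ part w = part v + 1 → R.Adj v w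

theorem zmod_add_ne {k : ℕ} (hk : 4 ≤ k) (i : ZMod k) :
    i + 1 ≠ i ∧ i - 1 ≠ i ∧ i + 1 + 1 ≠ i ∧ i + 1 ≠ i - 1 := by
  have h (n : ℕ) (h0 : 0 < n) (hn : n < k) : (n : ZMod k) ≠ 0 := fun h =>
    absurd (Nat.le_of_dvd h0 ((ZMod.natCast_eq_zero_iff n k).1 h)) (by omega)
  have h1 := h 1 (by omega) (by omega)
  have h2 := h 2 (by omega) (by omega)
  push_cast at h1 h2
  refine ⟨fun e => h1 ?_, fun e => h1 ?_, fun e => h2 ?_, fun e => h2 ?_⟩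
  · linear_combination e
  · linear_combination -e
  · linear_combination e
  · linear_combination e

theorem IsRingPartition.exists_ringCoords {V : Type*} {R : SimpleGraph V} {k : ℕ} (hk : 4 ≤ k)
    {X : ZMod k → Set V} (h : IsRingPartition R X) :
    ∃ (part : V → ZMod k) (pos : V → ℕ), RingCoords R part pos := by
  choose m u hinj hrange hlast hanti hzero using h.ordering
  have hex (v : V) : ∃ i, ∃ a : Fin (m i + 1), u i a = v := by
    have hv : v ∈ ⋃ i, X i := by rw [h.partition.cover]; trivial
    obtain ⟨i, hi⟩ := Set.mem_iUnion.1 hv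
    rw [← hrange] at hi
    exact ⟨i, hi⟩
  choose part idx hu using hex
  have hmem (i) (a : Fin (m i + 1)) : u i a ∈ X i := hrange i ▸ Set.mem_range_self a
  have hpu (i) (a : Fin (m i + 1)) : part (u i a) = i := by
    by_contra hne
    refine Set.disjoint_left.1 (h.partition.disjoint _ _ hne) ?_ (hmem i a)
    have := hmem _ (idx (u i a))
    rwa [hu] at this
  have hpos (i) (a : Fin (m i + 1)) : (idx (u i a) : ℕ) = a := by
    -- The index `j` is kept general so that the dependent type `Fin (m j + 1)` can be rewritten.
    have aux : ∀ j, ∀ b : Fin (m j + 1), j = i → u j b = u i a → (b : ℕ) = a := by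
      rintro j b rfl hb
      exact congrArg Fin.val (hinj _ hb)
    exact aux _ _ (hpu i a) (hu _)
  have hX (i v) : v ∈ X i ↔ part v = i := by
    constructor
    · intro hv
      rw [← hrange] at hv
      obtain ⟨a, rfl⟩ := hv
      exact hpu i a
    · rintro rfl
      have := hmem _ (idx v)
      rwa [hu] at this
  have hnb (v w : V) : w ∈ closedNbhd R v ↔ w = v ∨ R.Adj v w := by
    simp [closedNbhd]
  have hmono (i) (a b : Fin (m i + 1)) (hab : a ≤ b) (w : V)
      (hw : w = u i b ∨ R.Adj (u i b) w) : w = u i a ∨ R.Adj (u i a) w :=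
    (hnb _ _).1 (hanti i a b hab ((hnb _ _).2 hw))
  refine ⟨part, fun v => idx v, ?_, ?_, ?_, ?_, ?_, ?_, ?_⟩
  · intro v w
    obtain ⟨i, a, rfl⟩ : ∃ i a, u i a = v := ⟨_, _, hu v⟩
    obtain ⟨j, b, rfl⟩ : ∃ i a, u i a = w := ⟨_, _, hu w⟩
    simp only [hpu, hpos]
    rintro rfl hab
    rw [Fin.ext hab]
  · intro v a ha
    obtain ⟨i, b, rfl⟩ : ∃ i a, u i a = v := ⟨_, _, hu v⟩
    simp only [hpos] at ha
    refine ⟨u i ⟨a, by omega⟩, ?_, ?_⟩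
    · rw [hpu, hpu]
    · rw [hpos]
  · exact fun i => ⟨u i 0, hpu _ _, by rw [hpos]; rfl⟩
  · intro v w
    obtain ⟨i, a, rfl⟩ : ∃ i a, u i a = v := ⟨_, _, hu v⟩
    intro hp hne
    have hw : w ∈ X i := (hX _ _).2 (by rw [← hp, hpu])
    rcases hmono i a _ (Fin.le_last a) w ((hnb _ _).1 (hlast i hw)) with h | h
    · exact absurd h.symm hne
    · exact h
  · intro v w
    obtain ⟨i, a, rfl⟩ : ∃ i a, u i a = v := ⟨_, _, hu v⟩
    intro hadj
    have hw : w ∈ closedNbhd R (u i 0) := hanti i 0 a (Fin.zero_le a) ((hnb _ _).2 (Or.inr hadj))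
    rw [hzero] at hw
    simp only [Set.mem_union, hX] at hw
    rw [hpu]
    tauto
  · intro v v' w
    obtain ⟨i, a, rfl⟩ : ∃ i a, u i a = v := ⟨_, _, hu v⟩
    obtain ⟨j, b, rfl⟩ : ∃ i a, u i a = v' := ⟨_, _, hu v'⟩
    simp only [hpu, hpos]
    rintro rfl hab hadj hne
    rcases hmono j b a hab w (Or.inr hadj) with h | h
    · exact absurd h.symm hne
    · exact h
  · intro v w
    obtain ⟨i, a, rfl⟩ : ∃ i a, u i a = v := ⟨_, _, hu v⟩
    simp only [hpu, hpos]
    intro ha hw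
    obtain rfl : a = 0 := Fin.ext ha
    have hw' : w ∈ closedNbhd R (u i 0) := by
      rw [hzero]
      simp only [Set.mem_union, hX]
      tauto
    rcases (hnb _ _).1 hw' with h | h
    · rw [h, hpu] at hw
      have := zmod_add_ne hk i
      rcases hw with h | h
      · exact absurd h.symm this.2.1
      · exact absurd h.symm this.1
    · exact h

/-! ### Hyperholes spanned by cycles, and the bounds they give. -/

namespace RingCoords

variable {V : Type*} {R : SimpleGraph V} {k : ℕ} {part : V → ZMod k} {pos : V → ℕ}

theorem adj_of_le (hC : RingCoords R part pos) {v w v' w' : V} (h : R.Adj v w)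
    (hne : part v ≠ part w) (hv : part v' = part v) (hv' : pos v' ≤ pos v)
    (hw : part w' = part w) (hw' : pos w' ≤ pos w) : R.Adj v' w' := by
  have h1 : R.Adj v' w := hC.adj_mono v v' w hv hv' h fun e => hne (by rw [← hv, e])
  exact (hC.adj_mono w w' v' hw hw' h1.symm fun e => hne (by rw [← hv, ← hw, e])).symm

/-- The initial segments of the parts that end in the vertices of a cycle form a hyperhole. -/
theorem isKHyperhole_induce (hC : RingCoords R part pos) (hk : 4 ≤ k) (Y : ZMod k → V)
    (hY : ∀ i, part (Y i) = i) (hadj : ∀ i, R.Adj (Y i) (Y (i + 1))) :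
    IsKHyperhole k (R.induce {v | pos v ≤ pos (Y (part v))}) := by
  have hnext (v w : V) (hv : pos v ≤ pos (Y (part v))) (hw : pos w ≤ pos (Y (part w)))
      (hvw : part w = part v + 1) : R.Adj v w := by
    have hne := (zmod_add_ne hk (part v)).1
    refine hC.adj_of_le (hadj (part v)) (by rw [hY, hY]; exact hne.symm) (hY _).symm hv
      (by rw [hY, hvw]) (by rwa [← hvw])
  refine ⟨hk, fun i => {x | part x.1 = i}, ⟨?_, ?_, ?_⟩, ?_, ?_, ?_⟩
  · exact fun i => ⟨⟨Y i, by simp [hY]⟩, hY i⟩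
  · intro i j hij
    rw [Set.disjoint_left]
    rintro x rfl hx
    exact hij hx
  · ext x
    simp
  · rintro i x rfl y hy hne
    exact hC.adj_same _ _ (Eq.symm hy) fun e => hne (Subtype.ext e)
  · rintro i x rfl y (hy | hy)
    · exact (hnext y.1 x.1 y.2 x.2 (by rw [Set.mem_ofPred_eq] at hy; rw [hy]; ring)).symm
    · exact hnext x.1 y.1 x.2 y.2 hy
  · rintro i x rfl y hy h
    have := hC.adj_part _ _ h
    simp only [Set.mem_union, Set.mem_ofPred_eq] at hy
    tauto

/-- First vertices are adjacent to everything in the neighbouring parts, so they complete any edge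
to a cycle. -/
theorem exists_cycle_of_adj (hC : RingCoords R part pos) (hk : 4 ≤ k) {v w : V} (h : R.Adj v w)
    (hvw : part w = part v + 1) :
    ∃ Y : ZMod k → V, (∀ i, part (Y i) = i) ∧ (∀ i, R.Adj (Y i) (Y (i + 1))) ∧
      Y (part v) = v ∧ Y (part w) = w := by
  classical
  choose F hF hF0 using hC.exists_first
  have h1 := zmod_add_ne hk (part v)
  have hne : part w ≠ part v := hvw ▸ h1.1
  refine ⟨fun i => if i = part v then v else if i = part w then w else F i, ?_, ?_, ?_, ?_⟩
  · intro i
    dsimp only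
    split_ifs with h h' <;> simp_all
  · intro i
    dsimp only
    by_cases hi : i = part v
    · subst hi
      rw [if_pos rfl, if_neg h1.1, if_pos hvw.symm]
      exact h
    · rw [if_neg hi]
      by_cases hi' : i = part w
      · subst hi'
        rw [if_pos rfl, if_neg (by rw [hvw]; exact h1.2.2.1), if_neg (zmod_add_ne hk _).1]
        exact (hC.adj_first _ _ (hF0 _) (Or.inl (by rw [hF]; ring))).symm
      · rw [if_neg hi']
        refine hC.adj_first _ _ (hF0 _) (Or.inr ?_)
        rw [hF]
        split_ifs with h h' <;> simp_all
  · simp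
  · simp [hne]

variable [Fintype V]

/-- The initial segment of a part that ends in `v` has `pos v + 1` elements. -/
theorem card_initial [DecidableEq (ZMod k)] (hC : RingCoords R part pos) (v : V) :
    #{u | part u = part v ∧ pos u ≤ pos v} = pos v + 1 := by
  rw [← card_range (pos v + 1)]
  refine card_bij (fun u _ => pos u) ?_ ?_ ?_
  · intro u hu
    simp at hu ⊢
    omega
  · intro a ha b hb hab
    simp at ha hb
    exact hC.ext a b (ha.1.trans hb.1.symm) hab
  · intro a ha
    obtain ⟨w, hw, rfl⟩ := hC.exists_le v a (by simpa [Nat.lt_succ_iff] using ha)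
    exact ⟨w, by simpa [hw, Nat.lt_succ_iff] using ha, rfl⟩

/-- The initial segments ending in `v` and `w` form a clique inside a hyperhole. -/
theorem clique_le (hC : RingCoords R part pos) (hk : 4 ≤ k) {r : ℕ}
    (hr : ∀ S : Set V, IsKHyperhole k (R.induce S) → (R.induce S).Colorable r)
    {v w : V} (h : R.Adj v w) (hvw : part w = part v + 1) : (pos v + 1) + (pos w + 1) ≤ r := by
  classical
  obtain ⟨Y, hY, hadj, hYv, hYw⟩ := hC.exists_cycle_of_adj hk h hvw
  obtain ⟨c⟩ := hr _ (hC.isKHyperhole_induce hk Y hY hadj)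
  have hne : part v ≠ part w := hvw ▸ (zmod_add_ne hk (part v)).1.symm
  rw [← hC.card_initial v, ← hC.card_initial w, ← card_union_of_disjoint]
  · set A : Finset V := univ.filter (fun u => part u = part v ∧ pos u ≤ pos v) ∪
      univ.filter (fun u => part u = part w ∧ pos u ≤ pos w)
    have hA (u : V) (hu : u ∈ A) : pos u ≤ pos (Y (part u)) := by
      simp only [A, mem_union, mem_filter, mem_univ, true_and] at hu
      rcases hu with ⟨h1, h2⟩ | ⟨h1, h2⟩
      · rwa [h1, hYv]
      · rwa [h1, hYw]
    rw [← card_attach, ← Fintype.card_fin r, ← card_univ]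
    refine card_le_card_of_injOn (fun u => c ⟨u.1, hA u.1 u.2⟩) (by simp) ?_
    intro a _ b _ hab
    by_contra hne'
    refine c.valid (v := ⟨a.1, hA a.1 a.2⟩) (w := ⟨b.1, hA b.1 b.2⟩) ?_ hab
    change R.Adj a.1 b.1
    have hne'' : a.1 ≠ b.1 := fun e => hne' (Subtype.ext e)
    have ha := a.2
    have hb := b.2
    simp only [A, mem_union, mem_filter, mem_univ, true_and] at ha hb
    rcases ha with ⟨a1, a2⟩ | ⟨a1, a2⟩ <;> rcases hb with ⟨b1, b2⟩ | ⟨b1, b2⟩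
    · exact hC.adj_same _ _ (a1.trans b1.symm) hne''
    · exact hC.adj_of_le h hne a1 a2 b1 b2
    · exact hC.adj_of_le h.symm hne.symm a1 a2 b1 b2
    · exact hC.adj_same _ _ (a1.trans b1.symm) hne''
  · rw [disjoint_left]
    intro u hu hu'
    simp only [mem_filter, mem_univ, true_and] at hu hu'
    exact hne (hu.1.symm.trans hu'.1)

theorem pos_lt (hC : RingCoords R part pos) (hk : 4 ≤ k) {r : ℕ}
    (hr : ∀ S : Set V, IsKHyperhole k (R.induce S) → (R.induce S).Colorable r) (v : V) :
    pos v < r := by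
  obtain ⟨w, hw, hw0⟩ := hC.exists_first (part v + 1)
  have := hC.clique_le hk hr (hC.adj_first w v hw0 (Or.inl (by rw [hw]; ring))).symm hw
  omega

/-- A stable set of the hyperhole has at most `m` vertices, so `r` colour classes cover at most `m *
r`. -/
theorem hole_le (hC : RingCoords R part pos) (hk : 4 ≤ k) {r m : ℕ} [NeZero k] (hm : k = 2 * m + 1)
    (hr : ∀ S : Set V, IsKHyperhole k (R.induce S) → (R.induce S).Colorable r)
    (Y : ZMod k → V) (hY : ∀ i, part (Y i) = i) (hadj : ∀ i, R.Adj (Y i) (Y (i + 1))) :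
    ∑ i, (pos (Y i) + 1) ≤ m * r := by
  classical
  have hH := hC.isKHyperhole_induce hk Y hY hadj
  obtain ⟨c⟩ := hr _ hH
  have hnext (v w : V) (hv : pos v ≤ pos (Y (part v))) (hw : pos w ≤ pos (Y (part w)))
      (hvw : part w = part v + 1) : R.Adj v w := by
    refine hC.adj_of_le (hadj (part v)) ?_ (hY _).symm hv (by rw [hY, hvw]) (by rwa [← hvw])
    rw [hY, hY]
    exact (zmod_add_ne hk (part v)).1.symm
  have hsum : ∑ i, (pos (Y i) + 1) = Fintype.card {v | pos v ≤ pos (Y (part v))} := by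
    rw [← card_univ, card_eq_sum_card_fiberwise (f := fun x => part x.1) (t := univ) (by simp)]
    refine sum_congr rfl fun i _ => ?_
    rw [← hC.card_initial (Y i)]
    symm
    refine card_bij (fun x _ => x.1) ?_ ?_ ?_
    · rintro ⟨x, hx⟩ hi
      simp at hi hx
      subst hi
      simpa [hY] using hx
    · intro a _ b _ h
      exact Subtype.ext h
    · intro b hb
      simp only [hY, mem_filter, mem_univ, true_and] at hb
      obtain ⟨rfl, hb⟩ := hb
      exact ⟨⟨b, hb⟩, by simp, rfl⟩
  rw [hsum, ← card_univ, card_eq_sum_card_fiberwise (f := c) (t := univ) (by simp)]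
  calc _ ≤ ∑ _t : Fin r, m := sum_le_sum fun t _ => ?_
    _ = m * r := by simp [mul_comm]
  set B : Finset {v | pos v ≤ pos (Y (part v))} := {x | c x = t}
  have hst (x y) (hx : x ∈ B) (hy : y ∈ B) : ¬ R.Adj x.1 y.1 := fun h => by
    simp only [B, mem_filter, mem_univ, true_and] at hx hy
    exact c.valid (v := x) (w := y) h (hx.trans hy.symm)
  set I := B.image fun x => part x.1
  have hI : #I = #B := card_image_of_injOn fun x hx y hy hxy => by
    by_contra hne
    exact hst x y hx hy (hC.adj_same _ _ hxy fun e => hne (Subtype.ext e))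
  have hI' : #(I.image (· + 1)) = #I := card_image_of_injective _ (add_left_injective 1)
  have hdisj : Disjoint I (I.image (· + 1)) := by
    rw [disjoint_left]
    intro i hi hi'
    simp only [I, mem_image] at hi hi'
    obtain ⟨y, hy, rfl⟩ := hi
    obtain ⟨_, ⟨x, hx, rfl⟩, h⟩ := hi'
    exact hst x y hx hy (hnext _ _ x.2 y.2 h.symm)
  -- The parts met by a colour class and their successors are disjoint among `2 * m + 1` parts.
  have := card_le_univ (I ∪ I.image (· + 1))
  rw [card_union_of_disjoint hdisj, ZMod.card] at this
  omega

/-! ### Rings of even length. -/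

theorem colorable_of_even (hC : RingCoords R part pos) (hk : 4 ≤ k) {r : ℕ} (hev : Even k)
    (hr : ∀ S : Set V, IsKHyperhole k (R.induce S) → (R.induce S).Colorable r) :
    R.Colorable r := by
  have : NeZero k := ⟨by omega⟩
  have hpos := hC.pos_lt hk hr
  have hval (i : ZMod k) : (i + 1).val % 2 = (i.val + 1) % 2 := by
    rw [ZMod.val_add, ZMod.val_one'' (by omega), Nat.mod_mod_of_dvd _ hev.two_dvd]
  -- Equal colours would force `pos v + pos w = r - 1`, against `clique_le`.
  have hnext (v w : V) (h : R.Adj v w) (hvw : part w = part v + 1) :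
      (if (part v).val % 2 = 0 then pos v else r - 1 - pos v) ≠
        (if (part w).val % 2 = 0 then pos w else r - 1 - pos w) := by
    have h1 := hC.clique_le hk hr h hvw
    have h2 := hval (part v)
    rw [← hvw] at h2
    split_ifs <;> omega
  refine ⟨SimpleGraph.Coloring.mk (fun v =>
    ⟨if (part v).val % 2 = 0 then pos v else r - 1 - pos v, ?_⟩) ?_⟩
  · have := hpos v
    split_ifs <;> omega
  · intro v w h heq
    simp only [Fin.mk.injEq] at heq
    rcases hC.adj_part v w h with hvw | hvw | hvw
    · exact hnext w v h.symm (by rw [hvw]; ring) heq.symm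
    · refine h.ne (hC.ext v w hvw.symm ?_)
      have h1 := hpos v
      have h2 := hpos w
      rw [hvw] at heq
      split_ifs at heq <;> omega
    · exact hnext v w h hvw heq

end RingCoords
-- Greedy colouring.
/-- Greedy colouring along a well-founded relation: each `v` gets the colour of least `key v` that
is not used by its predecessors. -/
theorem exists_greedy {V : Type*} [Fintype V] {r : ℕ} (E : V → V → Prop) [DecidableRel E]
    (hE : WellFounded E) (hcard : ∀ v, #{w | E w v} < r) (key : V → Fin r → ℕ) :
    ∃ c : V → Fin r, (∀ v w, E w v → c w ≠ c v) ∧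
      ∀ v t, key v t < key v (c v) → ∃ w, E w v ∧ c w = t := by
  classical
  have step (v : V) (f : ∀ w, E w v → Fin r) : ∃ t, (∀ w h, f w h ≠ t) ∧
      ∀ t', key v t' < key v t → ∃ w h, f w h = t' := by
    have hne : (univ.filter fun t => ∀ w h, f w h ≠ t).Nonempty := by
      by_contra hemp
      have hsurj : Function.Surjective fun w : {w // E w v} => f w.1 w.2 := fun t => by
        by_contra hno
        refine hemp ⟨t, mem_filter.2 ⟨mem_univ _, fun w h e => hno ⟨⟨w, h⟩, e⟩⟩⟩
      have h1 := Fintype.card_le_of_surjective _ hsurj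
      have h2 := hcard v
      rw [Fintype.card_fin, Fintype.card_subtype] at h1
      omega
    obtain ⟨t, ht, hmin⟩ := exists_min_image _ (key v) hne
    refine ⟨t, (mem_filter.1 ht).2, fun t' ht' => ?_⟩
    by_contra hno
    push Not at hno
    have := hmin t' (mem_filter.2 ⟨mem_univ _, hno⟩)
    omega
  choose g hg using step
  have hfix (v : V) : hE.fix g v = g v fun w _ => hE.fix g w := hE.fix_eq g v
  refine ⟨hE.fix g, fun v w h => ?_, fun v t ht => ?_⟩
  · rw [hfix v]
    exact (hg v fun w _ => hE.fix g w).1 w h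
  · rw [hfix v] at ht
    obtain ⟨w, h, e⟩ := (hg v _).2 t ht
    exact ⟨w, h, e⟩

theorem zmod_eq_add_one {k : ℕ} [NeZero k] {i j : ZMod k} (h : i.val + 1 = j.val) : j = i + 1 := by
  rw [← ZMod.natCast_zmod_val j, ← h]
  simp

/-- `w` precedes `v` if it lies before `v` in its part, or in the preceding part and is adjacent
to `v`; the parts are taken in the order `0, 1, …, k - 1`. -/
def Precedes {V : Type*} (R : SimpleGraph V) {k : ℕ} (part : V → ZMod k) (pos : V → ℕ)
    (w v : V) : Prop :=
  (part w = part v ∧ pos w < pos v) ∨ ((part w).val + 1 = (part v).val ∧ R.Adj w v)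

theorem wellFounded_precedes {V : Type*} (R : SimpleGraph V) {k : ℕ} (part : V → ZMod k)
    (pos : V → ℕ) : WellFounded (Precedes R part pos) := by
  refine Subrelation.wf (r := InvImage (Prod.Lex (· < ·) (· < ·))
    fun v => ((part v).val, pos v)) ?_ (InvImage.wf _ (WellFounded.prod_lex wellFounded_lt
      wellFounded_lt))
  rintro w v (⟨h, h'⟩ | ⟨h, -⟩)
  · change Prod.Lex _ _ ((part w).val, pos w) ((part v).val, pos v)
    rw [h]
    exact Prod.Lex.right _ h'
  · exact Prod.Lex.left _ _ (by omega)

/-- The number of vertices up to `y` in the part of `y` whose colour is in `D`. -/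
noncomputable def initialCount {V : Type*} [Fintype V] {k r : ℕ} (part : V → ZMod k) (pos : V → ℕ)
    (c : V → Fin r) (D : Finset (Fin r)) (y : V) : ℕ :=
  open Classical in #{u | part u = part y ∧ pos u ≤ pos y ∧ c u ∈ D}

/-- A closed walk that visits the parts in the order `k - 1, …, 0`, indexed by `ZMod k`. -/
theorem exists_cycle_of_trace {V : Type*} {R : SimpleGraph V} {k : ℕ} {part : V → ZMod k}
    (pos : V → ℕ) (hk : 4 ≤ k) [NeZero k] {m : ℕ} (hm : k = 2 * m + 1) (y : ℕ → V)
    (hy0 : (part (y 0)).val = 2 * m)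
    (hy : ∀ d < 2 * m, (part (y (d + 1))).val + 1 = (part (y d)).val ∧ R.Adj (y (d + 1)) (y d))
    (hwrap : R.Adj (y (2 * m)) (y 0)) :
    ∃ Y : ZMod k → V, (∀ i, part (Y i) = i) ∧ (∀ i, R.Adj (Y i) (Y (i + 1))) ∧
      ∑ i, (pos (Y i) + 1) = ∑ d ∈ range (2 * m + 1), (pos (y d) + 1) := by
  have hval (d : ℕ) (hd : d ≤ 2 * m) : (part (y d)).val + d = 2 * m := by
    induction d with
    | zero => exact hy0
    | succ d ih =>
      have := (hy d (by omega)).1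
      have := ih (by omega)
      omega
  subst hm
  have hlt (i : ZMod (2 * m + 1)) : i.val ≤ 2 * m := Nat.lt_succ_iff.1 (ZMod.val_lt i)
  -- The walk descends from part `2 * m`, so it is in part `i` at time `2 * m - i.val`.
  refine ⟨fun i => y (2 * m - i.val), fun i => ZMod.val_injective _ ?_, fun i => ?_, ?_⟩
  · have := hval (2 * m - i.val) (by omega)
    have := hlt i
    dsimp only
    omega
  · have hi := hlt i
    by_cases h : i.val = 2 * m
    · have h0 : (i + 1).val = 0 := by
        rw [← ZMod.natCast_zmod_val i, h]
        have : ((2 * m : ℕ) : ZMod (2 * m + 1)) + 1 = ((2 * m + 1 : ℕ) : ZMod (2 * m + 1)) := by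
          push_cast; ring
        rw [this, ZMod.natCast_self, ZMod.val_zero]
      simp only [h, h0, Nat.sub_self, Nat.sub_zero]
      exact hwrap.symm
    · have h1 : (i + 1).val = i.val + 1 := by
        rw [ZMod.val_add_of_lt, ZMod.val_one'' (by omega)]
        rw [ZMod.val_one'' (by omega)]
        omega
      have := (hy (2 * m - (i.val + 1)) (by omega)).2
      rw [show 2 * m - (i.val + 1) + 1 = 2 * m - i.val by omega] at this
      simp only [h1]
      exact this
  · rw [← sum_range_reflect]
    exact (Finset.sum_range (n := 2 * m + 1)
      (fun d => pos (y (2 * m + 1 - 1 - d)) + 1)).symm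

namespace RingCoords

variable {V : Type*} {R : SimpleGraph V} {k : ℕ} {part : V → ZMod k} {pos : V → ℕ}

/-- Only edges between the last part and part `0` escape the greedy order. -/
theorem precedes_or (hC : RingCoords R part pos) [NeZero k] {v w : V} (h : R.Adj v w) :
    Precedes R part pos v w ∨ Precedes R part pos w v ∨
    ((part v).val + 1 = k ∧ part w = 0) ∨ ((part w).val + 1 = k ∧ part v = 0) := by
  have hnext (v w : V) (h : R.Adj v w) (hvw : part w = part v + 1) :
      Precedes R part pos v w ∨ ((part v).val + 1 = k ∧ part w = 0) := by
    have hlt := ZMod.val_lt (part v)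
    by_cases hk : (part v).val + 1 = k
    · refine Or.inr ⟨hk, ?_⟩
      rw [hvw, ← ZMod.natCast_zmod_val (part v)]
      have : (((part v).val + 1 : ℕ) : ZMod k) = 0 := by rw [hk]; simp
      exact_mod_cast this
    · refine Or.inl (Or.inr ⟨?_, h⟩)
      rw [hvw, ZMod.val_add_of_lt, ZMod.val_one'' (by omega)]
      rw [ZMod.val_one'' (by omega)]
      omega
  rcases hC.adj_part v w h with hvw | hvw | hvw
  · have := hnext w v h.symm (by rw [hvw]; ring)
    tauto
  · rcases lt_trichotomy (pos v) (pos w) with hlt | heq | hlt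
    · exact Or.inl (Or.inl ⟨hvw.symm, hlt⟩)
    · exact absurd (hC.ext _ _ hvw.symm heq) h.ne
    · exact Or.inr (Or.inl (Or.inl ⟨hvw, hlt⟩))
  · have := hnext v w h hvw
    tauto

variable [Fintype V]

/-- With `z` the last neighbour of `v` in the preceding part, all predecessors lie in the two
segments ending in `v` and `z`, and `v` itself is not one. -/
theorem card_precedes_lt (hC : RingCoords R part pos) (hk : 4 ≤ k) {r : ℕ}
    [DecidableRel (Precedes R part pos)]
    (hr : ∀ S : Set V, IsKHyperhole k (R.induce S) → (R.induce S).Colorable r) (v : V) :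
    #{w | Precedes R part pos w v} < r := by
  classical
  have : NeZero k := ⟨by omega⟩
  obtain ⟨z₀, hz₀, hz₀'⟩ := hC.exists_first (part v - 1)
  obtain ⟨z, hz, hmax⟩ := exists_max_image (univ.filter fun u => part u = part v - 1 ∧ R.Adj u v)
    pos ⟨z₀, by simpa [hz₀] using hC.adj_first z₀ v hz₀' (Or.inr (by rw [hz₀]; ring))⟩
  simp only [mem_filter, mem_univ, true_and] at hz hmax
  have hle := hC.clique_le hk hr hz.2 (by rw [hz.1]; ring)
  have hsub : univ.filter (fun w => Precedes R part pos w v) ⊆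
      (univ.filter fun u => part u = part v ∧ pos u ≤ pos v).erase v ∪
        univ.filter fun u => part u = part z ∧ pos u ≤ pos z := by
    intro u hu
    simp only [mem_filter, mem_univ, true_and] at hu
    simp only [mem_union, mem_erase, mem_filter, mem_univ, true_and]
    rcases hu with ⟨h1, h2⟩ | ⟨h1, h2⟩
    · exact Or.inl ⟨fun e => by rw [e] at h2; exact lt_irrefl _ h2, h1, h2.le⟩
    · have hu : part u = part v - 1 := by rw [zmod_eq_add_one h1]; ring
      exact Or.inr ⟨hu.trans hz.1.symm, hmax u ⟨hu, h2⟩⟩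
  have h1 := (card_le_card hsub).trans (card_union_le _ _)
  rw [card_erase_of_mem (by simp), hC.card_initial, hC.card_initial] at h1
  omega

theorem initialCount_add_compl (hC : RingCoords R part pos) {r : ℕ} (c : V → Fin r)
    (D : Finset (Fin r)) (y : V) :
    initialCount part pos c D y + initialCount part pos c Dᶜ y = pos y + 1 := by
  classical
  rw [← hC.card_initial y, ← card_filter_add_card_filter_not (fun u => c u ∈ D), filter_filter,
    filter_filter]
  simp only [initialCount, mem_compl, and_assoc]

/-- If all colours of `D` occur among the predecessors of `y`, then they occur in initial segments
of the part of `y` and of the preceding part. -/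
theorem card_le_initialCount [NeZero k] {r : ℕ} (c : V → Fin r)
    (D : Finset (Fin r)) (y : V) (hD : ∀ t ∈ D, ∃ w, Precedes R part pos w y ∧ c w = t) :
    #D ≤ initialCount part pos c D y ∨ ∃ z, (part z).val + 1 = (part y).val ∧ R.Adj z y ∧
      c z ∈ D ∧ #D ≤ initialCount part pos c D y + initialCount part pos c D z := by
  classical
  set N : Finset V := {u | (part u).val + 1 = (part y).val ∧ R.Adj u y ∧ c u ∈ D} with hN
  have hsub : D ⊆ ((univ.filter fun u => part u = part y ∧ pos u ≤ pos y ∧ c u ∈ D) ∪ N).image c := by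
    intro t ht
    obtain ⟨w, hw, rfl⟩ := hD t ht
    refine mem_image_of_mem c ?_
    simp only [hN, mem_union, mem_filter, mem_univ, true_and]
    rcases hw with ⟨h1, h2⟩ | ⟨h1, h2⟩
    · exact Or.inl ⟨h1, h2.le, ht⟩
    · exact Or.inr ⟨h1, h2, ht⟩
  have hle : #D ≤ initialCount part pos c D y + #N := by
    refine (card_le_card hsub).trans (card_image_le.trans ((card_union_le _ _).trans_eq ?_))
    simp only [initialCount]
  rcases N.eq_empty_or_nonempty with hemp | hne
  · left
    simpa [hemp] using hle
  · right
    -- The furthest such neighbour has all of `N` in its initial segment.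
    obtain ⟨z, hz, hmax⟩ := exists_max_image N pos hne
    simp only [hN, mem_filter, mem_univ, true_and] at hz hmax
    refine ⟨z, hz.1, hz.2.1, hz.2.2, hle.trans (Nat.add_le_add_left (card_le_card ?_) _)⟩
    intro u hu
    simp only [hN, mem_filter, mem_univ, true_and] at hu ⊢
    refine ⟨ZMod.val_injective _ ?_, hmax u hu, hu.2.2⟩
    have := hz.1
    omega

/-! ### Rings of odd length. -/

theorem colorable_of_odd (hC : RingCoords R part pos) (hk : 4 ≤ k) {r m : ℕ}
    (hm : k = 2 * m + 1)
    (hr : ∀ S : Set V, IsKHyperhole k (R.induce S) → (R.induce S).Colorable r) :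
    R.Colorable r := by
  classical
  have : NeZero k := ⟨by omega⟩
  obtain ⟨c, hproper, hbest⟩ := exists_greedy (Precedes R part pos)
    (wellFounded_precedes R part pos) (hC.card_precedes_lt hk hr)
    -- Part `0` and odd parts prefer low colours, other even parts high ones.
    fun v t => if (part v).val = 0 ∨ (part v).val % 2 = 1 then t.val else r - t.val
  have hzero (n : ℕ) : ∀ v, part v = 0 → pos v = n → (c v).val = n := by
    induction n using Nat.strong_induction_on with
    | _ n ih =>
      rintro v hv rfl
      refine le_antisymm ?_ ?_
      · by_contra! hlt
        obtain ⟨w, hw, hcw⟩ := hbest v ⟨pos v, hlt.trans (c v).2⟩ (by simpa [hv] using hlt)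
        rcases hw with ⟨h1, h2⟩ | ⟨h1, h2⟩
        · have := ih _ h2 w (h1.trans hv) rfl
          rw [hcw] at this
          exact h2.ne this.symm
        · simp [hv] at h1
      · by_contra! hlt
        obtain ⟨w, hw, hpw⟩ := hC.exists_le v (c v).val hlt.le
        refine hproper v w (Or.inl ⟨hw, by omega⟩) (Fin.ext ?_)
        rw [ih _ hlt w (hw.trans hv) hpw]
  have hmain (v w : V) (hvw : R.Adj v w) (hv : (part v).val = 2 * m) (hw : part w = 0) :
      c v ≠ c w := by
    intro hcvw
    have hwv : part w = part v + 1 := by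
      rw [hw, ← ZMod.natCast_zmod_val (part v), hv]
      have : ((2 * m + 1 : ℕ) : ZMod k) = 0 := by rw [← hm]; simp
      exact_mod_cast this.symm
    set low : Finset (Fin r) := Iic (c w) with hlow
    have hcard : #low = pos w + 1 := by rw [hlow, Fin.card_Iic, hzero _ w hw rfl]
    have hcard' : #low + #lowᶜ = r := by rw [card_add_card_compl, Fintype.card_fin]
    -- Being the first low vertex of its part, `x` has low count `1`: the source of the surplus `1`
    -- in `key`.
    obtain ⟨x, hx, hmin⟩ := exists_min_image
      (univ.filter fun u => part u = part v ∧ c u ∈ low) pos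
      ⟨v, by simp [hlow, hcvw]⟩
    simp only [mem_filter, mem_univ, true_and] at hx hmin
    have hxv : pos x ≤ pos v := hmin v ⟨rfl, by simp [hlow, hcvw]⟩
    have hxw : R.Adj x w := hC.adj_of_le hvw (hwv ▸ (zmod_add_ne hk _).1.symm) hx.1 hxv rfl le_rfl
    have hxlow : initialCount part pos c low x = 1 := by
      rw [initialCount, card_eq_one]
      refine ⟨x, ?_⟩
      ext u
      simp only [mem_filter, mem_univ, true_and, mem_singleton]
      constructor
      · rintro ⟨h1, h2, h3⟩
        exact hC.ext _ _ h1 (le_antisymm h2 (hmin u ⟨h1.trans hx.1, h3⟩))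
      · rintro rfl
        exact ⟨rfl, le_rfl, hx.2⟩
    -- The colours that the part of `y` prefers; if `c y` is outside `D y`, all of `D y` was
    -- blocked.
    let D (y : V) : Finset (Fin r) := if (part y).val % 2 = 1 then low else lowᶜ
    have hstep (y : V) : ∃ z, (part y).val ≠ 0 → c y ∉ D y →
        #(D y) ≤ initialCount part pos c (D y) y ∨ ((part z).val + 1 = (part y).val ∧ R.Adj z y ∧
        c z ∈ D y ∧
          #(D y) ≤ initialCount part pos c (D y) y + initialCount part pos c (D y) z) := by
      by_cases h0 : (part y).val ≠ 0 ∧ c y ∉ D y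
      · have := card_le_initialCount (R := R) c (D y) y fun t ht => hbest y t ?_
        · rcases this with h | ⟨z, hz⟩
          · exact ⟨y, fun _ _ => Or.inl h⟩
          · exact ⟨z, fun _ _ => Or.inr hz⟩
        · have h2 := h0.2
          have := t.2
          have := (c y).2
          simp only [D] at h2 ht
          by_cases hodd : (part y).val % 2 = 1
          · simp only [hodd, if_true, hlow, mem_Iic, not_le, Fin.le_def] at h2 ht
            simp only [hodd, or_true, if_true]
            omega
          · simp only [hodd, if_false, hlow, mem_compl, mem_Iic, not_le, Fin.le_def] at h2 ht
            rw [if_neg (by tauto), if_neg (by tauto)]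
            omega
      · exact ⟨y, fun h1 h2 => absurd ⟨h1, h2⟩ h0⟩
    choose nxt hnxt using hstep
    let y (d : ℕ) : V := nxt^[d] x
    have hy (d : ℕ) : y (d + 1) = nxt (y d) := Function.iterate_succ_apply' nxt d x
    have hcl (z z' : V) (h : (part z).val + 1 = (part z').val) (h' : R.Adj z z') :=
      hC.clique_le hk hr h' (zmod_eq_add_one h)
    -- Splitting segments into low and high vertices, each blocking step adds `#lowᶜ` or `#low` in
    -- turn, so two steps add `r`. The two upper bounds pair consecutive segments, with and without
    -- `w`; they rule out that a trace stops early.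
    have key (j : ℕ) (hj : j ≤ m) : (part (y (2 * j))).val + 2 * j = 2 * m ∧ c (y (2 * j)) ∈ low ∧
        (∀ d < 2 * j, (part (y (d + 1))).val + 1 = (part (y d)).val ∧ R.Adj (y (d + 1)) (y d)) ∧
        1 + j * r + initialCount part pos c lowᶜ (y (2 * j)) ≤
          ∑ d ∈ range (2 * j + 1), (pos (y d) + 1) ∧
        ∑ d ∈ range (2 * j + 1), (pos (y d) + 1) + (pos w + 1) ≤ (j + 1) * r ∧
        ∑ d ∈ range (2 * j), (pos (y d) + 1) ≤ j * r := by
      induction j with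
      | zero =>
        have h1 := hC.initialCount_add_compl c low x
        have h2 := hC.clique_le hk hr hxw (by rw [hwv, hx.1])
        refine ⟨by simp [y, hx.1, hv], hx.2, by simp, ?_, ?_, by simp⟩
        · simp [y]
          omega
        · simp [y]
          omega
      | succ j ih =>
        obtain ⟨h1, h2, h3, h4, h5, h6⟩ := ih (by omega)
        have hjr : (j + 1) * r = j * r + r := by ring
        have hjr' : (j + 1 + 1) * r = j * r + r + r := by ring
        have hDa : D (y (2 * j)) = lowᶜ := if_neg (by omega)
        have ha := hnxt (y (2 * j)) (by omega) (by rw [hDa]; simpa using h2)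
        rw [hDa, ← hy] at ha
        -- Stopping here would leave `#lowᶜ` high vertices in one segment; adding `pos w + 1 = #low`
        -- exceeds `(j + 1) * r`.
        rcases ha with ha | ⟨ha1, ha2, ha3, ha4⟩
        · omega
        have hDb : D (y (2 * j + 1)) = low := if_pos (by omega)
        have hb := hnxt (y (2 * j + 1)) (by omega) (by rw [hDb]; simpa using ha3)
        rw [hDb, ← hy] at hb
        have hca := hcl _ _ ha1 ha2
        have hsum := hC.initialCount_add_compl c low (y (2 * j + 1))
        rw [sum_range_succ] at h4 h5
        -- Stopping here would make the segments up to `y (2 * j + 1)`, which pair into `j + 1`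
        -- cliques, exceed `(j + 1) * r`.
        rcases hb with hb | ⟨hb1, hb2, hb3, hb4⟩
        · omega
        have hcb := hcl _ _ hb1 hb2
        have hsum' := hC.initialCount_add_compl c low (y (2 * j + 1 + 1))
        rw [show 2 * (j + 1) = 2 * j + 1 + 1 by ring]
        refine ⟨by omega, hb3, ?_, ?_, ?_, ?_⟩
        · intro d hd
          rcases Nat.lt_or_ge d (2 * j) with hd' | hd'
          · exact h3 d hd'
          · obtain rfl | rfl : d = 2 * j ∨ d = 2 * j + 1 := by omega
            · exact ⟨ha1, ha2⟩
            · exact ⟨hb1, hb2⟩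
        · rw [sum_range_succ _ (2 * j + 1 + 1), sum_range_succ _ (2 * j + 1), sum_range_succ]
          omega
        · rw [sum_range_succ _ (2 * j + 1 + 1), sum_range_succ _ (2 * j + 1), sum_range_succ]
          omega
        · rw [sum_range_succ _ (2 * j + 1), sum_range_succ]
          omega
    obtain ⟨h1, h2, h3, h4, -, -⟩ := key m le_rfl
    have h0 : part (y (2 * m)) = 0 := (ZMod.val_eq_zero _).1 (by omega)
    -- In part `0` colour equals position, so the low end of the trace is not beyond `w` and
    -- inherits its adjacency to `x`.
    have hle : pos (y (2 * m)) ≤ pos w := by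
      rw [← hzero _ _ h0 rfl, ← hzero _ w hw rfl]
      simpa [hlow] using h2
    have hwrap : R.Adj (y (2 * m)) (y 0) :=
      (hC.adj_of_le hxw (by rw [hx.1, hwv]; exact (zmod_add_ne hk _).1.symm) rfl le_rfl
        (h0.trans hw.symm) hle).symm
    obtain ⟨Y, hY, hadj, hsum⟩ := exists_cycle_of_trace pos hk hm y
      (show (part x).val = 2 * m by rw [hx.1, hv]) h3 hwrap
    have := hC.hole_le hk hm hr Y hY hadj
    omega
  refine ⟨SimpleGraph.Coloring.mk c fun {v w} h => ?_⟩
  rcases hC.precedes_or h with h' | h' | h' | h'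
  · exact hproper _ _ h'
  · exact (hproper _ _ h').symm
  · exact hmain v w h (by omega) h'.2
  · exact (hmain w v h.symm (by omega) h'.2).symm

end RingCoords

/-! ### From colourability to the chromatic number. -/

/-- A `k`-ring is `r`-colourable if all its `k`-hyperholes are. -/
theorem IsKRing.colorable {V : Type*} [Finite V] {k : ℕ} {R : SimpleGraph V} (hR : IsKRing k R)
    {r : ℕ} (hr : ∀ S : Set V, IsKHyperhole k (R.induce S) → (R.induce S).Colorable r) :
    R.Colorable r := by
  have := Fintype.ofFinite V
  obtain ⟨hk, X, hX⟩ := hR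
  obtain ⟨part, pos, hC⟩ := hX.exists_ringCoords hk
  rcases Nat.even_or_odd k with hev | ⟨m, hm⟩
  · exact hC.colorable_of_even hk hev hr
  · exact hC.colorable_of_odd hk hm hr

theorem IsKRing.exists_isKHyperhole {V : Type*} [Finite V] {k : ℕ} {R : SimpleGraph V}
    (hR : IsKRing k R) : ∃ S : Set V, IsKHyperhole k (R.induce S) ∧
      (R.induce S).chromaticNumber = R.chromaticNumber := by
  have hle (S : Set V) : (R.induce S).chromaticNumber ≤ R.chromaticNumber :=
    SimpleGraph.chromaticNumber_mono_of_hom (SimpleGraph.Embedding.induce S).toHom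
  obtain ⟨n, hn⟩ := ENat.ne_top_iff_exists.1
    (SimpleGraph.chromaticNumber_ne_top_iff_exists.2 ⟨_, R.colorable_chromaticNumber_of_fintype⟩)
  by_contra! hno
  cases n with
  | zero =>
    obtain ⟨-, X, hX⟩ := hR
    obtain ⟨v, -⟩ := hX.partition.nonempty 0
    exact (SimpleGraph.chromaticNumber_eq_zero_iff.1 hn.symm).false v
  | succ r =>
    -- If every `k`-hyperhole had chromatic number below `r + 1`, so would `R`.
    have hcol : R.Colorable r := hR.colorable fun S hS => by
      have hlt := lt_of_le_of_ne (hle S) (hno S hS)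
      rw [← hn, Nat.cast_succ] at hlt
      exact SimpleGraph.chromaticNumber_le_iff_colorable.1 (Order.le_of_lt_add_one hlt)
    have h := hcol.chromaticNumber_le
    rw [← hn] at h
    exact absurd (Nat.cast_le.1 h) (by omega)

end ColoringRings

/-- The chromatic number of a `k`-ring is the maximum of the chromatic numbers of its induced
subgraphs that are `k`-hyperholes, and also the maximum over the induced subgraphs that are
hyperholes of any length. -/
theorem theorem1p2 {V : Type*} [Finite V] (k : ℕ) (hk : 4 ≤ k) (R : SimpleGraph V)
    (hR : ColoringRings.IsKRing k R) :
    IsGreatest {c : ℕ∞ | ∃ S : Set V, ColoringRings.IsKHyperhole k (R.induce S) ∧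
      (R.induce S).chromaticNumber = c} R.chromaticNumber ∧
    IsGreatest {c : ℕ∞ | ∃ (l : ℕ) (S : Set V), ColoringRings.IsKHyperhole l (R.induce S) ∧
      (R.induce S).chromaticNumber = c} R.chromaticNumber := by
  have hle (S : Set V) : (R.induce S).chromaticNumber ≤ R.chromaticNumber :=
    SimpleGraph.chromaticNumber_mono_of_hom (SimpleGraph.Embedding.induce S).toHom
  obtain ⟨S, hS, hSR⟩ := hR.exists_isKHyperhole
  refine ⟨⟨⟨S, hS, hSR⟩, ?_⟩, ⟨k, S, hS, hSR⟩, ?_⟩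
  · rintro _ ⟨S, -, rfl⟩
    exact hle S
  · rintro _ ⟨l, S, -, rfl⟩
    exact hle S
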